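/- Let $\alpha\in(0,1)$, $T>0$, $\lambda\ge 0$, and let $\Omega\subset\mathbb R^d$, $d\in\{1,2,3\}$, be a bounded Lipschitz domain; $\langle\cdot,\cdot\rangle$ and $\|\cdot\|$ are the inner product and norm of $L_2(\Omega)$, and also $\langle\cdot,\cdot\rangle$ is the duality pairing of functionals on $H^1_0(\Omega)$ with functions in $H^1_0(\Omega)$. Let $\mathcal L$ be a linear (second-order elliptic) operator mapping $H_0^1(\Omega)$ to functionals on $H_0^1(\Omega)$, with $\langle\mathcal Lv,v\rangle\ge\lambda\|v\|^2$ for all $v\in H^1_0(\Omega)$. Let $D_t^\alpha$ be the Caputo derivative in time, $$D_t^\alpha v(t)=\frac1{\Gamma(1-\alpha)}\int_0^t(t-s)^{-\alpha}\,\partial_sv(s)\,ds ,$$ where $\partial_s v$ is taken in the sense of distributions (a jump of $v$ at $0$ contributes a Dirac mass) and the integral is improper at $0$, that is, $$D_t^\alpha v(t)=\frac1{\Gamma(1-\alpha)}\lim_{\epsilon\to0^+}\Bigl\{t^{-\alpha}[v(\epsilon)-v(0)]+\int_\epsilon^t(t-s)^{-\alpha}\,\partial_sv(s)\,ds\Bigr\}.$$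 Let $u$ and $u_h$ be in $L_\infty(0,t;L_2(\Omega))\cap W^{1,\infty}(\epsilon,t;L_2(\Omega))$ for any $0<\epsilon<t\le T$, with $u(\cdot,t),u_h(\cdot,t)\in H^1_0(\Omega)$ for $0<t\le T$ and $u(\cdot,0)=u_h(\cdot,0)=u_0\in L_2(\Omega)$. Suppose that $D_t^\alpha u+\mathcal Lu=f$ for $0<t\le T$, and that the residual $R_h(\cdot,t)=(D_t^\alpha+\mathcal L)u_h(\cdot,t)-f(\cdot,t)$ is in $L_2(\Omega)$ for $0<t\le T$. Set $e=u_h-u$, $\beta=1-\alpha$ and, for a parameter $\tau>0$ and $s,t>0$, $$\mathcal R_0(t)=\frac{t^{-\alpha}}{\Gamma(1-\alpha)}+\lambda,\qquad \mathcal E_1(t)=\max\{\tau,t\}^{\alpha-1},\qquad \rho(s)=s^{-\beta}\bigl[1-(\max\{0,1-s\})^\beta\bigr],\qquad \mathcal R_1(t)=\frac{t^{-1}\rho(\tau/t)}{\Gamma(1-\alpha)}+\lambda\,\mathcal E_1(t).$$ Then for every $\tau>0$ and $0<t\le T$ one has (with suprema in $[0,\infty]$) $$\|e(\cdot,t)\|\le\sup_{0<s\le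 t}\frac{\|R_h(\cdot,s)\|}{\mathcal R_0(s)},\qquad \|e(\cdot,t)\|\le t^{\alpha-1}\sup_{0<s\le t}\frac{\|R_h(\cdot,s)\|}{\mathcal R_1(s)},\qquad \|e(\cdot,t)\|\le \mathcal E_1(t)\sup_{0<s\le t}\frac{\|R_h(\cdot,s)\|}{\mathcal R_1(s)}.$$ Moreover, $\rho(s)\ge s^{-\beta}\min\{\beta s,1\}$ for all $s>0$. -/

import Mathlib

open MeasureTheory Set Filter Topology
open scoped ENNReal ContDiff

noncomputable section

namespace FracParabolic

/-- The Hilbert space `L₂(Ω)` of real-valued functions, for `Ω ⊆ ℝ^d`. -/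
abbrev L2 {d : ℕ} (Ω : Set (EuclideanSpace ℝ (Fin d))) : Type :=
  Lp ℝ 2 (volume.restrict Ω)

/-- The pairs `(φ, ∇φ)`, as elements of `L₂(Ω) × L₂(Ω)^d`, with `φ ∈ C_c^∞(Ω)`. -/
def testGraph {d : ℕ} (Ω : Set (EuclideanSpace ℝ (Fin d))) :
    Submodule ℝ (L2 Ω × (Fin d → L2 Ω)) where
  carrier := {p | ∃ φ : EuclideanSpace ℝ (Fin d) → ℝ,
    ContDiff ℝ ∞ φ ∧ HasCompactSupport φ ∧ tsupport φ ⊆ Ω ∧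
    (p.1 =ᵐ[volume.restrict Ω] φ) ∧
    ∀ i, p.2 i =ᵐ[volume.restrict Ω] fun x => fderiv ℝ φ x (EuclideanSpace.single i 1)}
  zero_mem' := by
    refine ⟨fun _ => 0, contDiff_const, HasCompactSupport.zero, ?_, Lp.coeFn_zero _ _ _, ?_⟩
    · have h : tsupport (fun _ : EuclideanSpace ℝ (Fin d) => (0 : ℝ)) = ∅ :=
        tsupport_eq_empty_iff.2 rfl
      rw [h]
      exact empty_subset _
    · intro i
      filter_upwards [Lp.coeFn_zero ℝ 2 (volume.restrict Ω)] with x hx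
      simpa using hx
  add_mem' := by
    rintro p q ⟨φ, h1, h2, h3, h4, h5⟩ ⟨ψ, k1, k2, k3, k4, k5⟩
    refine ⟨φ + ψ, h1.add k1, h2.add k2,
      (tsupport_add φ ψ).trans (union_subset h3 k3), ?_, ?_⟩
    · filter_upwards [h4, k4, Lp.coeFn_add p.1 q.1] with x a b c
      rw [Prod.fst_add, c, Pi.add_apply, Pi.add_apply, a, b]
    · intro i
      filter_upwards [h5 i, k5 i, Lp.coeFn_add (p.2 i) (q.2 i)] with x a b c
      rw [Prod.snd_add, Pi.add_apply, c, Pi.add_apply, a, b,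
        fderiv_add (h1.differentiable (by simp) x) (k1.differentiable (by simp) x)]
      rfl
  smul_mem' := by
    rintro c p ⟨φ, h1, h2, h3, h4, h5⟩
    refine ⟨c • φ, h1.const_smul c, h2.mono (Function.support_const_smul_subset c φ),
      (closure_mono (Function.support_const_smul_subset c φ)).trans h3, ?_, ?_⟩
    · filter_upwards [h4, Lp.coeFn_smul c p.1] with x a b
      rw [Prod.smul_fst, b, Pi.smul_apply, Pi.smul_apply, a]
    · intro i
      filter_upwards [h5 i, Lp.coeFn_smul c (p.2 i)] with x a b
      rw [Prod.smul_snd, Pi.smul_apply, b, Pi.smul_apply, a,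
        fderiv_const_smul (h1.differentiable (by simp) x)]
      rfl

/-- `H¹₀(Ω)`, as a subspace of `L₂(Ω)`: the closure of `C_c^∞(Ω)` in the `H¹` norm, that is, the
first components of the limits of pairs `(φₙ, ∇φₙ)` in `L₂(Ω) × L₂(Ω)^d`. -/
def H10 {d : ℕ} (Ω : Set (EuclideanSpace ℝ (Fin d))) : Submodule ℝ (L2 Ω) :=
  (testGraph Ω).topologicalClosure.map (LinearMap.fst ℝ (L2 Ω) (Fin d → L2 Ω))

section Time

variable {H : Type*} [NormedAddCommGroup H] [NormedSpace ℝ H]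

/-- `v ∈ W^{1,∞}(a,b;H)` (the continuous representative on `[a,b]`): `v` and `∂ₜ v` are essentially
bounded and `v` is the integral of `∂ₜ v`. Such a `v` is differentiable almost everywhere, and its
weak derivative `∂ₜ v` is the almost everywhere derivative `deriv v`. -/
def MemW1Inf (a b : ℝ) (v : ℝ → H) : Prop :=
  MemLp v ∞ (volume.restrict (Ioo a b)) ∧
  MemLp (deriv v) ∞ (volume.restrict (Ioo a b)) ∧
  ∀ s ∈ Icc a b, ∀ t ∈ Icc a b, v t - v s = ∫ r in s..t, deriv v r

/-- `v ∈ L_∞(0,t;H) ∩ W^{1,∞}(ε,t;H)` for any `0 < ε < t ≤ T`. Nothing is assumed on the behaviour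
of `v` at `0`, apart from boundedness: `v` may be discontinuous there. -/
def TimeRegular (T : ℝ) (v : ℝ → H) : Prop :=
  ∀ ε t : ℝ, 0 < ε → ε < t → t ≤ T →
    MemLp v ∞ (volume.restrict (Ioo 0 t)) ∧ MemW1Inf ε t v

/-- The fractional integral `J_t^{1-α} w (t) = Γ(1-α)⁻¹ ∫₀ᵗ (t-s)^{-α} w(s) ds`. -/
def fracInt (α : ℝ) (w : ℝ → H) (t : ℝ) : H :=
  (Real.Gamma (1 - α))⁻¹ • ∫ s in (0 : ℝ)..t, (t - s) ^ (-α) • w s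

/-- The Caputo derivative `D_t^α v (t) = J_t^{1-α}(∂ₜ v)(t)` for `t > 0`, where `∂ₜ v` is understood
on `[0,t]` in the sense of distributions: a jump of `v` at `0` contributes a Dirac mass at `0`, and
the integral over `(0,t)` is improper at `0`. So
`D_t^α v (t) = Γ(1-α)⁻¹ lim_{ε → 0+} { t^{-α} (v(ε) - v(0)) + ∫_ε^t (t-s)^{-α} ∂ₛ v(s) ds }`.
For every `v` with `TimeRegular T v` and every `0 < t ≤ T` the limit exists (`H` complete,
`0 < α < 1`) and equals
`Γ(1-α)⁻¹ { t^{-α} (v(t) - v(0)) + ∫₀ᵗ α (t-s)^{-α-1} (v(t) - v(s)) ds }`.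
If `v` is continuous at `0` and `(t-s)^{-α} ∂ₛ v` is integrable, it is the ordinary
`J_t^{1-α}(∂ₜ v)(t)`: see `caputoDeriv_eq_fracInt`. -/
def caputoDeriv (α : ℝ) (v : ℝ → H) (t : ℝ) : H :=
  limUnder (𝓝[>] (0 : ℝ)) fun ε : ℝ =>
    (Real.Gamma (1 - α))⁻¹ •
      (t ^ (-α) • (v ε - v 0) + ∫ s in ε..t, (t - s) ^ (-α) • deriv v s)

/-- For functions that are continuous at `0` with integrable derivative, `caputoDeriv` is the
classical Caputo derivative `J_t^{1-α}(∂ₜ v)`. -/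
theorem caputoDeriv_eq_fracInt {α t : ℝ} {v : ℝ → H} (ht : 0 < t)
    (hv : ContinuousWithinAt v (Ioi 0) 0)
    (hint : IntervalIntegrable (fun s => (t - s) ^ (-α) • deriv v s) volume 0 t) :
    caputoDeriv α v t = fracInt α (deriv v) t := by
  refine Tendsto.limUnder_eq ?_
  unfold fracInt
  refine Tendsto.const_smul ?_ _
  have h1 : Tendsto (fun ε : ℝ => t ^ (-α) • (v ε - v 0)) (𝓝[>] 0) (𝓝 0) := by
    have := (hv.tendsto.sub_const (v 0)).const_smul (t ^ (-α))
    simpa using this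
  have h2 : Tendsto (fun ε : ℝ => ∫ s in ε..t, (t - s) ^ (-α) • deriv v s) (𝓝[>] 0)
      (𝓝 (∫ s in (0 : ℝ)..t, (t - s) ^ (-α) • deriv v s)) := by
    have hc := intervalIntegral.continuousOn_primitive_interval_left
      (a := (0 : ℝ)) (b := t) (μ := volume)
      (f := fun s => (t - s) ^ (-α) • deriv v s)
      (by
        rw [uIcc_of_le ht.le, integrableOn_Icc_iff_integrableOn_Ioc]
        exact (intervalIntegrable_iff_integrableOn_Ioc_of_le ht.le).1 hint)
    have h0 := (hc 0 left_mem_uIcc).tendsto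
    refine h0.mono_left ?_
    rw [uIcc_of_le ht.le, ← nhdsWithin_Ioc_eq_nhdsGT ht]
    exact nhdsWithin_mono _ Ioc_subset_Icc_self
  simpa using h1.add h2

end Time

/-- `ρ(s) = s^{-β} [1 - ((1-s)⁺)^β]` with `β = 1 - α`. -/
def rho (α s : ℝ) : ℝ :=
  s ^ (-(1 - α)) * (1 - (max 0 (1 - s)) ^ (1 - α))

/-- `𝓔₁(t) = max{τ, t}^{α-1}`. -/
def E1 (α τ t : ℝ) : ℝ := (max τ t) ^ (α - 1)

/-- `𝓡₀(t) = Γ(1-α)⁻¹ t^{-α} + λ`. -/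
def R0 (α lam t : ℝ) : ℝ := (Real.Gamma (1 - α))⁻¹ * t ^ (-α) + lam

/-- `𝓡₁(t) = Γ(1-α)⁻¹ t⁻¹ ρ(τ/t) + λ 𝓔₁(t)`. -/
def R1 (α lam τ t : ℝ) : ℝ :=
  (Real.Gamma (1 - α))⁻¹ * t⁻¹ * rho α (τ / t) + lam * E1 α τ t

end FracParabolic

end

/-! The argument is a maximum principle for ‖e(t)‖ with an explicit barrier. Testing the error
equation with e(t) itself gives ⟨D_t^α e, e⟩ + λ‖e‖² ≤ ‖R_h‖‖e‖. The barrier `K * E1 α τ`, cut to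
jump from 0 at time 0, has fractional derivative K t⁻¹ρ(τ/t)/Γ(1-α) (`kernelTrunc_E1`). Adding λ
times the barrier gives exactly K `R1`, so K is taken to be the supremum of ‖R_h‖/`R1`.

Since e is only bounded near 0, a term η s^{α-1} is added. It blows up at 0 and so dominates e
there, while its fractional derivative is nonnegative. If the bound fails at the final time, a small
η leaves ‖e‖ - K `E1` - η s^{α-1} with a positive maximum c at some t > 0. Then ⟨e(t), e(s)⟩ ≤
‖e(t)‖ (c + K `E1` + η s^{α-1}) for s ≤ t, with equality at s = t. A scalar function with maximum
value 0 at t has nonnegative fractional derivative at t (`HasBddDeriv.kernelTrunc_nonneg`). The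
result is a lower bound for ⟨e(t), D_t^α e(t)⟩ containing the strictly positive term t^{-α}c‖e(t)‖,
which contradicts the energy inequality (`inner_ge_of_touches`, `norm_le_of_residual_le`).

Inequalities are proved for truncations at ε > 0 and passed to the limit;
`exists_tendsto_kernelTrunc` shows that the limit exists. The bound with `R0` is the case τ = T, and
the one with t^{α-1} follows from `E1` ≤ t^{α-1}. -/

namespace FracParabolic

/-! ### Integration by parts and the kernel (t-s)^{-α} -/

/-- Integration by parts of a `C¹` function against the derivative of an absolutely continuous
one. -/
theorem integral_mul_of_primitive {k k' g p : ℝ → ℝ} {a b : ℝ} (hab : a ≤ b)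
    (hk : ∀ x ∈ Icc a b, HasDerivAt k (k' x) x) (hk' : ContinuousOn k' (Icc a b))
    (hp : IntervalIntegrable p volume a b)
    (hg : ∀ s ∈ Icc a b, g s = g a + ∫ r in a..s, p r) :
    ∫ s in a..b, k s * p s = k b * g b - k a * g a - ∫ s in a..b, k' s * g s := by
  rw [← uIcc_of_le hab] at hk hk' hg
  set G : ℝ → ℝ := fun s => ∫ r in a..s, p r with hG
  have hGac : AbsolutelyContinuousOnInterval G a b :=
    hp.absolutelyContinuousOnInterval_intervalIntegral (c := a) left_mem_uIcc
  have hk'i : IntervalIntegrable k' volume a b := hk'.intervalIntegrable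
  have hkeq : ∀ s ∈ uIcc a b, k s = k a + ∫ r in a..s, k' r := by
    intro s hs
    rw [intervalIntegral.integral_eq_sub_of_hasDerivAt
      (fun x hx => hk x (uIcc_subset_uIcc_left hs hx))
      (hk'i.mono_set (uIcc_subset_uIcc_left hs))]
    ring
  have hkac : AbsolutelyContinuousOnInterval (fun s => ∫ r in a..s, k' r) a b :=
    hk'i.absolutelyContinuousOnInterval_intervalIntegral (c := a) left_mem_uIcc
  -- Parts is applied to the primitives k - k(a) and g - g(a), whose absolute continuity is
  -- automatic; the constants are restored at the end.
  have h := AbsolutelyContinuousOnInterval.integral_mul_deriv_eq_deriv_mul hkac hGac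
  have hsub : uIoc a b ⊆ uIcc a b := uIoc_subset_uIcc
  have h1 : ∫ s in a..b, (∫ r in a..s, k' r) * deriv G s = ∫ s in a..b, (k s - k a) * p s := by
    apply intervalIntegral.integral_congr_ae
    filter_upwards [hp.ae_hasDerivAt_integral] with x hx hxm
    rw [(hx (hsub hxm) a left_mem_uIcc).deriv, hkeq x (hsub hxm)]
    ring
  have h2 : ∫ s in a..b, deriv (fun s => ∫ r in a..s, k' r) s * G s
      = ∫ s in a..b, k' s * (g s - g a) := by
    apply intervalIntegral.integral_congr_ae
    filter_upwards [hk'i.ae_hasDerivAt_integral] with x hx hxm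
    rw [(hx (hsub hxm) a left_mem_uIcc).deriv, hg x (hsub hxm)]
    simp [hG]
  have hkc : ContinuousOn k (uIcc a b) := fun x hx => (hk x hx).continuousAt.continuousWithinAt
  have hgc : ContinuousOn g (uIcc a b) :=
    (continuousOn_const.add hGac.continuousOn).congr hg
  rw [h1, h2] at h
  simp_rw [sub_mul, mul_sub] at h
  rw [intervalIntegral.integral_sub (hp.continuousOn_mul hkc) (hp.const_mul _),
    intervalIntegral.integral_sub (hk'i.mul_continuousOn hgc) (hk'i.mul_const _),
    intervalIntegral.integral_const_mul, intervalIntegral.integral_mul_const] at h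
  have e1 := hg b right_mem_uIcc
  have e2 := hkeq b right_mem_uIcc
  have e3 : ∫ r in a..b, p r = g b - g a := by linarith
  have e4 : ∫ r in a..b, k' r = k b - k a := by linarith
  simp only [hG, e3, e4, intervalIntegral.integral_same] at h
  linear_combination h

/-- The kernel `(t-s)^{-α}` and its derivative. -/
theorem hasDerivAt_kernel {α t s : ℝ} (hs : s < t) :
    HasDerivAt (fun s : ℝ => (t - s) ^ (-α)) (α * (t - s) ^ (-α - 1)) s := by
  have h := ((hasDerivAt_id s).const_sub t).rpow_const (p := -α)
    (Or.inl (by simpa using (sub_pos.2 hs).ne'))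
  exact h.congr_deriv (by simp)

theorem continuousOn_kernel_deriv {α t a b : ℝ} (hb : b < t) :
    ContinuousOn (fun s : ℝ => α * (t - s) ^ (-α - 1)) (Icc a b) := by
  refine continuousOn_const.mul (ContinuousOn.rpow_const (by fun_prop) fun s hs => Or.inl ?_)
  exact (sub_pos.2 (hs.2.trans_lt hb)).ne'

theorem kernel_mono {α t r s : ℝ} (hα : 0 < α) (hrs : r ≤ s) (hs : s < t) :
    (t - r) ^ (-α) ≤ (t - s) ^ (-α) :=
  Real.rpow_le_rpow_of_nonpos (sub_pos.2 hs) (by linarith) (by linarith)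

theorem intervalIntegrable_kernel {α t a : ℝ} (hα1 : α < 1) :
    IntervalIntegrable (fun s : ℝ => (t - s) ^ (-α)) volume a t := by
  have h := (intervalIntegral.intervalIntegrable_rpow' (a := t - a) (b := 0)
    (by linarith : -1 < -α)).comp_sub_left t
  simpa using h

/-! ### Functions with bounded derivative and truncated Caputo derivatives -/

section Pairs

variable {H : Type*} [NormedAddCommGroup H] [NormedSpace ℝ H]

/-- `v` is on `[a,b]` a primitive of the essentially bounded function `q`. -/
structure HasBddDeriv (a b : ℝ) (v q : ℝ → H) : Prop where
  memLp : MemLp q ∞ (volume.restrict (Ioo a b))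
  integral_eq : ∀ s ∈ Icc a b, ∀ r ∈ Icc a b, v r - v s = ∫ x in s..r, q x

namespace HasBddDeriv

variable {a b : ℝ} {v w q p : ℝ → H}

theorem mono (h : HasBddDeriv a b v q) {a' b' : ℝ} (ha : a ≤ a') (hb : b' ≤ b) :
    HasBddDeriv a' b' v q where
  memLp := h.memLp.mono_measure (Measure.restrict_mono (Ioo_subset_Ioo ha hb) le_rfl)
  integral_eq s hs r hr :=
    h.integral_eq s (Icc_subset_Icc ha hb hs) r (Icc_subset_Icc ha hb hr)

theorem aestronglyMeasurable (h : HasBddDeriv a b v q) :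
    AEStronglyMeasurable q (volume.restrict (Ioc a b)) := by
  rw [← restrict_Ioo_eq_restrict_Ioc]
  exact h.memLp.1

theorem exists_bound (h : HasBddDeriv a b v q) :
    ∃ C, 0 ≤ C ∧ ∀ᵐ x ∂volume.restrict (Ioc a b), ‖q x‖ ≤ C := by
  rw [← restrict_Ioo_eq_restrict_Ioc]
  refine ⟨(eLpNorm q ∞ (volume.restrict (Ioo a b))).toReal, ENNReal.toReal_nonneg, ?_⟩
  have h2 := h.memLp.2
  rw [eLpNorm_exponent_top] at *
  filter_upwards [ae_le_eLpNormEssSup (f := q) (μ := volume.restrict (Ioo a b))] with x hx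
  have := ENNReal.toReal_mono h2.ne hx
  simpa using this

theorem intervalIntegrable_mul (h : HasBddDeriv a b v q) (hab : a ≤ b) {k : ℝ → ℝ}
    (hk : IntervalIntegrable k volume a b) :
    IntervalIntegrable (fun s => k s • q s) volume a b := by
  rw [intervalIntegrable_iff_integrableOn_Ioc_of_le hab] at *
  obtain ⟨C, -, hC⟩ := h.exists_bound
  exact hk.smul_bdd C h.aestronglyMeasurable hC

theorem intervalIntegrable (h : HasBddDeriv a b v q) (hab : a ≤ b) :
    IntervalIntegrable q volume a b := by
  simpa using h.intervalIntegrable_mul hab (k := fun _ => (1 : ℝ)) intervalIntegrable_const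

theorem exists_lipschitz (h : HasBddDeriv a b v q) :
    ∃ C, 0 ≤ C ∧ ∀ s ∈ Icc a b, ∀ r ∈ Icc a b, ‖v r - v s‖ ≤ C * |r - s| := by
  obtain ⟨C, hC0, hC⟩ := h.exists_bound
  refine ⟨C, hC0, fun s hs r hr => ?_⟩
  rw [h.integral_eq s hs r hr]
  apply intervalIntegral.norm_integral_le_of_norm_le_const_ae
  rw [ae_restrict_iff' measurableSet_Ioc] at hC
  filter_upwards [hC] with x hx hxm
  refine hx ?_
  rw [uIoc, mem_Ioc] at hxm
  exact ⟨(le_min hs.1 hr.1).trans_lt hxm.1, hxm.2.trans (max_le hs.2 hr.2)⟩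

theorem continuousOn (h : HasBddDeriv a b v q) : ContinuousOn v (Icc a b) := by
  obtain ⟨C, hC0, hC⟩ := h.exists_lipschitz
  have : LipschitzOnWith ⟨C, hC0⟩ v (Icc a b) := by
    refine LipschitzOnWith.of_dist_le_mul fun x hx y hy => ?_
    rw [dist_eq_norm, Real.dist_eq]
    exact hC y hy x hx
  exact this.continuousOn

theorem sub (h : HasBddDeriv a b v q) (h' : HasBddDeriv a b w p) :
    HasBddDeriv a b (fun s => v s - w s) (fun s => q s - p s) where
  memLp := h.memLp.sub h'.memLp
  integral_eq s hs r hr := by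
    have hab : a ≤ b := hs.1.trans hs.2
    have hsub : uIcc s r ⊆ uIcc a b := by
      rw [uIcc_of_le hab]; exact uIcc_subset_Icc hs hr
    rw [intervalIntegral.integral_sub ((h.intervalIntegrable hab).mono_set hsub)
      ((h'.intervalIntegrable hab).mono_set hsub), ← h.integral_eq s hs r hr,
      ← h'.integral_eq s hs r hr]
    abel

theorem add (h : HasBddDeriv a b v q) (h' : HasBddDeriv a b w p) :
    HasBddDeriv a b (fun s => v s + w s) (fun s => q s + p s) where
  memLp := h.memLp.add h'.memLp
  integral_eq s hs r hr := by
    have hab : a ≤ b := hs.1.trans hs.2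
    have hsub : uIcc s r ⊆ uIcc a b := by
      rw [uIcc_of_le hab]; exact uIcc_subset_Icc hs hr
    rw [intervalIntegral.integral_add ((h.intervalIntegrable hab).mono_set hsub)
      ((h'.intervalIntegrable hab).mono_set hsub), ← h.integral_eq s hs r hr,
      ← h'.integral_eq s hs r hr]
    abel

theorem const_smul (h : HasBddDeriv a b v q) (c : ℝ) :
    HasBddDeriv a b (fun s => c • v s) (fun s => c • q s) where
  memLp := h.memLp.const_smul c
  integral_eq s hs r hr := by
    rw [intervalIntegral.integral_smul, ← h.integral_eq s hs r hr, smul_sub]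

end HasBddDeriv

theorem hasBddDeriv_const (a b : ℝ) (c : H) : HasBddDeriv a b (fun _ => c) (fun _ => 0) where
  memLp := MemLp.zero'
  integral_eq := by simp

/-- The expression under the limit in the Caputo derivative of a function vanishing at `0`. -/
noncomputable def kernelTrunc (α t : ℝ) (v q : ℝ → H) (ε : ℝ) : H :=
  t ^ (-α) • v ε + ∫ s in ε..t, (t - s) ^ (-α) • q s

end Pairs

section Linear

variable {H : Type*} [NormedAddCommGroup H] [NormedSpace ℝ H] {α t ε : ℝ} {v w q p : ℝ → H}

theorem kernelTrunc_add (hα1 : α < 1) (hε : ε ≤ t) (h : HasBddDeriv ε t v q)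
    (h' : HasBddDeriv ε t w p) :
    kernelTrunc α t (fun s => v s + w s) (fun s => q s + p s) ε
      = kernelTrunc α t v q ε + kernelTrunc α t w p ε := by
  unfold kernelTrunc
  simp_rw [smul_add]
  rw [intervalIntegral.integral_add
    (h.intervalIntegrable_mul hε (intervalIntegrable_kernel hα1))
    (h'.intervalIntegrable_mul hε (intervalIntegrable_kernel hα1))]
  abel

theorem kernelTrunc_sub (hα1 : α < 1) (hε : ε ≤ t) (h : HasBddDeriv ε t v q)
    (h' : HasBddDeriv ε t w p) :
    kernelTrunc α t (fun s => v s - w s) (fun s => q s - p s) ε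
      = kernelTrunc α t v q ε - kernelTrunc α t w p ε := by
  unfold kernelTrunc
  simp_rw [smul_sub]
  rw [intervalIntegral.integral_sub
    (h.intervalIntegrable_mul hε (intervalIntegrable_kernel hα1))
    (h'.intervalIntegrable_mul hε (intervalIntegrable_kernel hα1))]
  abel

theorem kernelTrunc_smul (c : ℝ) :
    kernelTrunc α t (fun s => c • v s) (fun s => c • q s) ε = c • kernelTrunc α t v q ε := by
  unfold kernelTrunc
  simp_rw [smul_comm _ c]
  rw [intervalIntegral.integral_smul, smul_add]

theorem kernelTrunc_const (c : H) :
    kernelTrunc α t (fun _ => c) (fun _ => 0) ε = t ^ (-α) • c := by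
  simp [kernelTrunc]

end Linear

section Inner

variable {H : Type*} [NormedAddCommGroup H] [InnerProductSpace ℝ H] [CompleteSpace H]
  {α t ε : ℝ} {v q : ℝ → H}

theorem integral_inner_left {a b : ℝ} {f : ℝ → H} (hf : IntervalIntegrable f volume a b) (y : H) :
    ∫ s in a..b, inner ℝ y (f s) = inner ℝ y (∫ s in a..b, f s) :=
  (innerSL ℝ y).intervalIntegral_comp_comm hf

theorem HasBddDeriv.inner_left {a b : ℝ} (h : HasBddDeriv a b v q) (y : H) :
    HasBddDeriv a b (fun s => (inner ℝ y (v s) : ℝ)) (fun s => inner ℝ y (q s)) where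
  memLp := h.memLp.const_inner y
  integral_eq s hs r hr := by
    have hab : a ≤ b := hs.1.trans hs.2
    have hsub : uIcc s r ⊆ uIcc a b := by
      rw [uIcc_of_le hab]; exact uIcc_subset_Icc hs hr
    rw [integral_inner_left ((h.intervalIntegrable hab).mono_set hsub),
      ← h.integral_eq s hs r hr, inner_sub_right]

/-- Reduces estimates of Hilbert-space valued truncations to scalar ones. -/
theorem kernelTrunc_inner (hα1 : α < 1) (hε : ε ≤ t) (h : HasBddDeriv ε t v q) (y : H) :
    kernelTrunc α t (fun s => (inner ℝ y (v s) : ℝ)) (fun s => inner ℝ y (q s)) ε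
      = inner ℝ y (kernelTrunc α t v q ε) := by
  unfold kernelTrunc
  rw [inner_add_right, ← integral_inner_left
    (h.intervalIntegrable_mul hε (intervalIntegrable_kernel hα1))]
  simp_rw [real_inner_smul_right]
  rfl

end Inner

/-! ### Scalar estimates: maximum principle and dependence on the truncation -/

section Scalar

variable {α t a : ℝ} {g q : ℝ → ℝ}

/-- Integration by parts against the kernel, away from its singularity. -/
theorem HasBddDeriv.integral_kernel_mul {b : ℝ} (h : HasBddDeriv a t g q) (hab : a ≤ b)
    (hb : b < t) :
    ∫ s in a..b, (t - s) ^ (-α) * q s = (t - b) ^ (-α) * g b - (t - a) ^ (-α) * g a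
      - ∫ s in a..b, α * (t - s) ^ (-α - 1) * g s := by
  have h' := h.mono le_rfl hb.le
  refine integral_mul_of_primitive hab (fun x hx => hasDerivAt_kernel (hx.2.trans_lt hb))
    (continuousOn_kernel_deriv hb) (h'.intervalIntegrable hab) fun s hs => ?_
  have := h'.integral_eq a ⟨le_rfl, hab⟩ s hs
  linarith

/-- Fractional differentiation at a maximum: if `g ≤ 0 = g t`, then the truncated
Caputo derivative of `g` at `t` is nonnegative. -/
theorem HasBddDeriv.kernelTrunc_nonneg (hα0 : 0 < α) (hα1 : α < 1) (ha : 0 ≤ a) (hat : a < t)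
    (h : HasBddDeriv a t g q) (hg : ∀ s ∈ Icc a t, g s ≤ 0) (hgt : g t = 0) :
    0 ≤ kernelTrunc α t g q a := by
  obtain ⟨C, hC0, hC⟩ := h.exists_lipschitz
  have hk := intervalIntegrable_kernel (t := t) (a := a) hα1
  have hi : IntervalIntegrable (fun s => (t - s) ^ (-α) * q s) volume a t :=
    h.intervalIntegrable_mul hat.le hk
  have hcont : ContinuousOn (fun b => ∫ s in a..b, (t - s) ^ (-α) * q s) (uIcc a t) :=
    intervalIntegral.continuousOn_primitive_interval
      (by rw [uIcc_of_le hat.le, integrableOn_Icc_iff_integrableOn_Ioc]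
          exact (intervalIntegrable_iff_integrableOn_Ioc_of_le hat.le).1 hi)
  have hlim : Tendsto (fun b => ∫ s in a..b, (t - s) ^ (-α) * q s) (𝓝[<] t)
      (𝓝 (∫ s in a..t, (t - s) ^ (-α) * q s)) := by
    refine (hcont t right_mem_uIcc).tendsto.mono_left ?_
    rw [uIcc_of_le hat.le, ← nhdsWithin_Ico_eq_nhdsLT hat]
    exact nhdsWithin_mono _ Ico_subset_Icc_self
  -- After parts on [a,b], the boundary term (t-b)^{-α} g(b) is at least -C (t-b)^{1-α}, because g
  -- is Lipschitz and g(t) = 0. It disappears as b → t since α < 1.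
  have hlim2 : Tendsto (fun b => -(C * (t - b) ^ (1 - α)) - (t - a) ^ (-α) * g a) (𝓝[<] t)
      (𝓝 (-(C * (t - t) ^ (1 - α)) - (t - a) ^ (-α) * g a)) := by
    refine Tendsto.mono_left ?_ nhdsWithin_le_nhds
    refine Continuous.tendsto ?_ t
    have : Continuous fun b : ℝ => (t - b) ^ (1 - α) :=
      (continuous_const.sub continuous_id).rpow_const fun _ => Or.inr (by linarith)
    fun_prop
  have key := le_of_tendsto_of_tendsto hlim2 hlim (by
    filter_upwards [Ioo_mem_nhdsLT hat] with b hb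
    rw [h.integral_kernel_mul hb.1.le hb.2]
    have h1 : ∫ s in a..b, α * (t - s) ^ (-α - 1) * g s ≤ 0 := by
      rw [intervalIntegral.integral_of_le hb.1.le]
      refine setIntegral_nonpos measurableSet_Ioc fun s hs => ?_
      have hst : 0 ≤ t - s := by linarith [hs.2, hb.2]
      exact mul_nonpos_of_nonneg_of_nonpos
        (mul_nonneg hα0.le (Real.rpow_nonneg hst _)) (hg s ⟨hs.1.le, hs.2.trans hb.2.le⟩)
    have h2 : -(C * (t - b)) ≤ g b := by
      have := hC t ⟨hat.le, le_rfl⟩ b ⟨hb.1.le, hb.2.le⟩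
      rw [hgt, sub_zero, Real.norm_eq_abs, abs_sub_comm, abs_of_pos (sub_pos.2 hb.2)] at this
      exact (abs_le.1 this).1
    have hpos : 0 < t - b := sub_pos.2 hb.2
    have h3 : (t - b) ^ (1 - α) = (t - b) ^ (-α) * (t - b) := by
      rw [sub_eq_neg_add 1 α, Real.rpow_add hpos, Real.rpow_one]
    rw [h3]
    have := mul_le_mul_of_nonneg_left h2 (Real.rpow_nonneg hpos.le (-α))
    linarith)
  rw [sub_self, Real.zero_rpow (by linarith)] at key
  -- What remains at the left end is (t^{-α} - (t-a)^{-α}) g(a), a product of two nonpositive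
  -- factors.
  have h4 : (t : ℝ) ^ (-α) ≤ (t - a) ^ (-α) := by
    simpa using kernel_mono (α := α) hα0 ha hat
  have h5 := mul_le_mul_of_nonpos_right h4 (hg a ⟨le_rfl, hat.le⟩)
  simp only [kernelTrunc, smul_eq_mul]
  linarith

/-- The truncated Caputo derivative varies little with the truncation. -/
theorem HasBddDeriv.abs_kernelTrunc_sub_le {b M : ℝ} (hα0 : 0 < α) (hα1 : α < 1) (ha : 0 ≤ a)
    (hab : a ≤ b) (hb : b < t) (h : HasBddDeriv a t g q) (hM : ∀ s ∈ Icc a b, |g s| ≤ M) :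
    |kernelTrunc α t g q a - kernelTrunc α t g q b|
      ≤ 2 * M * ((t - b) ^ (-α) - t ^ (-α)) := by
  have hi : IntervalIntegrable (fun s => (t - s) ^ (-α) * q s) volume a t :=
    h.intervalIntegrable_mul (hab.trans hb.le) (intervalIntegrable_kernel hα1)
  have hat : a ≤ t := hab.trans hb.le
  have hsplit := intervalIntegral.integral_add_adjacent_intervals
    (hi.mono_set (uIcc_subset_uIcc_left (by rw [uIcc_of_le hat]; exact ⟨hab, hb.le⟩)))
    (hi.mono_set (uIcc_subset_uIcc_right (by rw [uIcc_of_le hat]; exact ⟨hab, hb.le⟩)))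
  have hparts := h.integral_kernel_mul (α := α) hab hb
  have hM0 : 0 ≤ M := (abs_nonneg _).trans (hM a ⟨le_rfl, hab⟩)
  have hk'c := continuousOn_kernel_deriv (α := α) (t := t) (a := a) (b := b) hb
  have hk'i : IntervalIntegrable (fun s => α * (t - s) ^ (-α - 1)) volume a b := by
    rw [← uIcc_of_le hab] at hk'c
    exact hk'c.intervalIntegrable
  have hint : |∫ s in a..b, α * (t - s) ^ (-α - 1) * g s|
      ≤ M * ((t - b) ^ (-α) - (t - a) ^ (-α)) := by
    have e : ∫ s in a..b, α * (t - s) ^ (-α - 1) = (t - b) ^ (-α) - (t - a) ^ (-α) := by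
      refine intervalIntegral.integral_eq_sub_of_hasDerivAt (f := fun s => (t - s) ^ (-α))
        (fun x hx => ?_) hk'i
      rw [uIcc_of_le hab] at hx
      exact hasDerivAt_kernel (hx.2.trans_lt hb)
    rw [← e, ← intervalIntegral.integral_const_mul, ← Real.norm_eq_abs]
    refine intervalIntegral.norm_integral_le_of_norm_le hab ?_ (hk'i.const_mul M)
    refine Eventually.of_forall fun s hs => ?_
    have hst : 0 ≤ t - s := by linarith [hs.2]
    have hnn := mul_nonneg hα0.le (Real.rpow_nonneg hst (-α - 1))
    rw [Real.norm_eq_abs, abs_mul, abs_of_nonneg hnn, mul_comm]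
    exact mul_le_mul_of_nonneg_right (hM s ⟨hs.1.le, hs.2⟩) hnn
  have h1 : (t : ℝ) ^ (-α) ≤ (t - a) ^ (-α) := by
    simpa using kernel_mono (α := α) hα0 ha (hab.trans_lt hb)
  have h2 : (t - a) ^ (-α) ≤ (t - b) ^ (-α) := kernel_mono hα0 hab hb
  -- With k(s) = (t-s)^{-α}, the three terms are at most M times k(b) - k(0), k(a) - k(0) and k(b) -
  -- k(a), which add up to 2(k(b) - k(0)).
  have e : kernelTrunc α t g q a - kernelTrunc α t g q b
      = ((t - b) ^ (-α) - t ^ (-α)) * g b - ((t - a) ^ (-α) - t ^ (-α)) * g a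
        - ∫ s in a..b, α * (t - s) ^ (-α - 1) * g s := by
    simp only [kernelTrunc, smul_eq_mul]
    linear_combination hparts - hsplit
  rw [e]
  have b1 : |((t - b) ^ (-α) - t ^ (-α)) * g b| ≤ ((t - b) ^ (-α) - t ^ (-α)) * M := by
    rw [abs_mul, abs_of_nonneg (by linarith)]
    exact mul_le_mul_of_nonneg_left (hM b ⟨hab, le_rfl⟩) (by linarith)
  have b2 : |((t - a) ^ (-α) - t ^ (-α)) * g a| ≤ ((t - a) ^ (-α) - t ^ (-α)) * M := by
    rw [abs_mul, abs_of_nonneg (by linarith)]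
    exact mul_le_mul_of_nonneg_left (hM a ⟨le_rfl, hab⟩) (by linarith)
  refine (abs_sub _ _).trans ?_
  have := abs_sub (((t - b) ^ (-α) - t ^ (-α)) * g b) (((t - a) ^ (-α) - t ^ (-α)) * g a)
  linarith

end Scalar

/-! ### Existence of the Caputo limit -/

section Limit

variable {H : Type*} [NormedAddCommGroup H] [InnerProductSpace ℝ H] [CompleteSpace H]
  {α t : ℝ} {v q : ℝ → H}

/-- The scalar estimate is applied to ⟨y, v⟩ with y the difference to be bounded; one factor ‖y‖ is
then cancelled. -/
theorem norm_kernelTrunc_sub_le {a b M : ℝ} (hα0 : 0 < α) (hα1 : α < 1) (ha : 0 ≤ a)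
    (hab : a ≤ b) (hb : b < t) (h : HasBddDeriv a t v q) (hM : ∀ s ∈ Icc a b, ‖v s‖ ≤ M) :
    ‖kernelTrunc α t v q a - kernelTrunc α t v q b‖ ≤ 2 * M * ((t - b) ^ (-α) - t ^ (-α)) := by
  have hM0 : 0 ≤ M := (norm_nonneg _).trans (hM a ⟨le_rfl, hab⟩)
  have hk : 0 ≤ (t - b) ^ (-α) - t ^ (-α) := by
    have := kernel_mono (α := α) hα0 (ha.trans hab) hb
    rw [sub_zero] at this
    linarith
  set y := kernelTrunc α t v q a - kernelTrunc α t v q b with hy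
  have h1 := (h.inner_left y).abs_kernelTrunc_sub_le (M := ‖y‖ * M) hα0 hα1 ha hab hb
    fun s hs => (abs_real_inner_le_norm _ _).trans
      (mul_le_mul_of_nonneg_left (hM s hs) (norm_nonneg _))
  rw [kernelTrunc_inner hα1 (hab.trans hb.le) h,
    kernelTrunc_inner hα1 hb.le (h.mono hab le_rfl), ← inner_sub_right, ← hy,
    real_inner_self_eq_norm_sq, abs_of_nonneg (sq_nonneg _)] at h1
  rcases (norm_nonneg y).eq_or_lt with h0 | h0
  · rw [← h0]; positivity
  · refine le_of_mul_le_mul_left ?_ h0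
    linarith

/-- The limit in the definition of the Caputo derivative exists for bounded functions. -/
theorem exists_tendsto_kernelTrunc {M : ℝ} (hα0 : 0 < α) (hα1 : α < 1) (ht : 0 < t)
    (h : ∀ ε ∈ Ioo 0 t, HasBddDeriv ε t v q) (hM : ∀ s ∈ Ioc 0 t, ‖v s‖ ≤ M) :
    ∃ y, Tendsto (kernelTrunc α t v q) (𝓝[>] 0) (𝓝 y) := by
  rw [← cauchy_map_iff_exists_tendsto, Metric.cauchy_iff]
  refine ⟨inferInstance, fun δ hδ => ?_⟩
  have hlim : Tendsto (fun b : ℝ => 2 * M * ((t - b) ^ (-α) - t ^ (-α))) (𝓝[>] 0) (𝓝 0) := by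
    have : ContinuousAt (fun b : ℝ => 2 * M * ((t - b) ^ (-α) - t ^ (-α))) 0 := by
      refine continuousAt_const.mul (ContinuousAt.sub ?_ continuousAt_const)
      exact ContinuousAt.rpow_const (by fun_prop) (Or.inl (by simpa using ht.ne'))
    simpa using this.tendsto.mono_left nhdsWithin_le_nhds
  obtain ⟨b, hb, hbδ⟩ := ((eventually_mem_set.2 (Ioo_mem_nhdsGT ht)).and
    (hlim.eventually (gt_mem_nhds (half_pos hδ)))).exists
  refine ⟨kernelTrunc α t v q '' Ioc 0 b, image_mem_map (Ioc_mem_nhdsGT hb.1), ?_⟩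
  have key : ∀ a ∈ Ioc 0 b, dist (kernelTrunc α t v q a) (kernelTrunc α t v q b) < δ / 2 := by
    intro a ha
    rw [dist_eq_norm]
    refine (norm_kernelTrunc_sub_le hα0 hα1 ha.1.le ha.2 hb.2 (h a ⟨ha.1, ha.2.trans_lt hb.2⟩)
      fun s hs => hM s ⟨ha.1.trans_le hs.1, hs.2.trans hb.2.le⟩).trans_lt hbδ
  rintro _ ⟨x, hx, rfl⟩ _ ⟨y, hy, rfl⟩
  have := dist_triangle_right (kernelTrunc α t v q x) (kernelTrunc α t v q y)
    (kernelTrunc α t v q b)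
  linarith [key x hx, key y hy]

end Limit

/-! ### The barrier and its fractional derivative -/

section Barrier

variable {α τ t : ℝ}

/-- The right derivative of `E1 α τ`. -/
noncomputable def E1' (α τ : ℝ) : ℝ → ℝ :=
  (Ici τ).indicator fun s => (α - 1) * s ^ (α - 2)

theorem measurable_E1' : Measurable (E1' α τ) :=
  (by fun_prop : Measurable fun s : ℝ => (α - 1) * s ^ (α - 2)).indicator measurableSet_Ici

theorem continuous_E1 (hτ : 0 < τ) : Continuous (E1 α τ) :=
  (continuous_const.max continuous_id).rpow_const fun s => Or.inl (hτ.trans_le (le_max_left τ s)).ne'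

theorem norm_E1'_le (hα1 : α < 1) (hτ : 0 < τ) (s : ℝ) :
    ‖E1' α τ s‖ ≤ (1 - α) * τ ^ (α - 2) := by
  have hα : 0 ≤ 1 - α := by linarith
  rw [E1']
  by_cases hs : s ∈ Ici τ
  · rw [indicator_of_mem hs, norm_mul, Real.norm_of_nonpos (by linarith), neg_sub,
      Real.norm_of_nonneg (Real.rpow_nonneg (hτ.le.trans hs) _)]
    exact mul_le_mul_of_nonneg_left
      (Real.rpow_le_rpow_of_nonpos hτ hs (by linarith)) hα
  · rw [indicator_of_notMem hs, norm_zero]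
    positivity

/-- At the kink s = τ the right derivative is that of s^{α-1}, which is why the indicator in `E1'`
is that of a closed half-line. -/
theorem hasDerivWithinAt_E1 (hτ : 0 < τ) (s : ℝ) :
    HasDerivWithinAt (E1 α τ) (E1' α τ s) (Ioi s) s := by
  rcases lt_or_ge s τ with hs | hs
  · rw [E1', indicator_of_notMem (by simpa using hs)]
    refine (HasDerivAt.congr_of_eventuallyEq (hasDerivAt_const s (τ ^ (α - 1))) ?_).hasDerivWithinAt
    filter_upwards [Iio_mem_nhds hs] with x hx
    rw [E1, max_eq_left (le_of_lt hx)]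
  · rw [E1', indicator_of_mem (by simpa using hs)]
    have h := (Real.hasDerivAt_rpow_const (x := s) (p := α - 1)
      (Or.inl (hτ.trans_le hs).ne')).hasDerivWithinAt (s := Ioi s)
    rw [show α - 1 - 1 = α - 2 by ring] at h
    refine h.congr (fun x hx => ?_) ?_
    · rw [E1, max_eq_right (hs.trans (le_of_lt hx))]
    · rw [E1, max_eq_right hs]

theorem hasBddDeriv_E1 (hα1 : α < 1) (hτ : 0 < τ) (a b : ℝ) :
    HasBddDeriv a b (E1 α τ) (E1' α τ) where
  memLp := memLp_top_of_bound measurable_E1'.aestronglyMeasurable _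
    (Eventually.of_forall (norm_E1'_le hα1 hτ))
  integral_eq s hs r hr := by
    refine (intervalIntegral.integral_eq_sub_of_hasDeriv_right
      (continuous_E1 hτ).continuousOn (fun x _ => hasDerivWithinAt_E1 hτ x) ?_).symm
    refine intervalIntegrable_iff.2 ?_
    exact Measure.integrableOn_of_bounded (M := (1 - α) * τ ^ (α - 2)) (by simp [uIoc])
      measurable_E1'.aestronglyMeasurable (Eventually.of_forall (norm_E1'_le hα1 hτ))

theorem inv_mul_div_rpow (hτ : 0 < τ) (ht : 0 < t) :
    t⁻¹ * (τ / t) ^ (-(1 - α)) = t ^ (-α) * τ ^ (α - 1) := by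
  rw [Real.div_rpow hτ.le ht.le, neg_sub, Real.rpow_sub_one ht.ne', Real.rpow_neg ht.le]
  field_simp

/-- The fractional derivative of `E1`. -/
theorem kernelTrunc_E1 {ε : ℝ} (hα1 : α < 1) (hε : 0 < ε) (hετ : ε ≤ τ) (ht : ε < t) :
    kernelTrunc α t (E1 α τ) (E1' α τ) ε = t⁻¹ * rho α (τ / t) := by
  have hτ : 0 < τ := hε.trans_le hετ
  have ht0 : 0 < t := hε.trans ht
  have hE : E1 α τ ε = τ ^ (α - 1) := by rw [E1, max_eq_left hετ]
  have hzero : ∀ b ≤ τ, ε ≤ b → ∫ s in ε..b, (t - s) ^ (-α) * E1' α τ s = 0 := by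
    intro b hb hεb
    -- The endpoint b is removed because `E1'` need not vanish there when b = τ.
    rw [intervalIntegral.integral_of_le hεb, integral_Ioc_eq_integral_Ioo]
    refine setIntegral_eq_zero_of_forall_eq_zero fun s hs => ?_
    rw [E1', indicator_of_notMem (by simpa using hs.2.trans_le hb), mul_zero]
  have hrho := inv_mul_div_rpow (α := α) hτ ht0
  simp only [kernelTrunc, smul_eq_mul, hE, rho]
  rw [← mul_assoc, hrho]
  rcases le_or_gt t τ with h | h
  · rw [hzero t h ht.le, max_eq_left (by rw [sub_nonpos, le_div_iff₀ ht0]; linarith),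
      Real.zero_rpow (by linarith)]
    ring
  · have hi : IntervalIntegrable (fun s => (t - s) ^ (-α) * E1' α τ s) volume ε t :=
      (hasBddDeriv_E1 hα1 hτ ε t).intervalIntegrable_mul ht.le (intervalIntegrable_kernel hα1)
    have hmem : τ ∈ uIcc ε t := by rw [uIcc_of_le ht.le]; exact ⟨hετ, h.le⟩
    -- The antiderivative of (α-1)(t-s)^{-α}s^{α-2} comes from the substitution x = (t-s)/s, for
    -- which dx = -t s⁻² ds.
    have hint : ∫ s in τ..t, (t - s) ^ (-α) * E1' α τ s
        = t⁻¹ * ((t - t) / t) ^ (1 - α) - t⁻¹ * ((t - τ) / τ) ^ (1 - α) := by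
      refine intervalIntegral.integral_eq_sub_of_hasDerivAt_of_le h.le
        (f := fun s => t⁻¹ * ((t - s) / s) ^ (1 - α)) ?_ ?_
        (hi.mono_set (uIcc_subset_uIcc_right hmem))
      · refine continuousOn_const.mul (ContinuousOn.rpow_const ?_ fun s _ => Or.inr (by linarith))
        exact ContinuousOn.div (by fun_prop) (by fun_prop) fun s hs => (hτ.trans_le hs.1).ne'
      · intro s hs
        have hs0 : 0 < s := hτ.trans hs.1
        have hts : 0 < t - s := sub_pos.2 hs.2
        have h1 : HasDerivAt (fun s : ℝ => (t - s) / s) (-t / s ^ 2) s := by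
          have := ((hasDerivAt_id s).const_sub t).div (hasDerivAt_id s) hs0.ne'
          exact this.congr_deriv (by simp; ring)
        have h2 := (h1.rpow_const (p := 1 - α) (Or.inl (div_pos hts hs0).ne')).const_mul t⁻¹
        refine h2.congr_deriv ?_
        rw [E1', indicator_of_mem (by simpa using hs.1.le), show 1 - α - 1 = -α by ring,
          Real.div_rpow hts.le hs0.le, show α - 2 = α + (-2 : ℤ) by push_cast; ring,
          Real.rpow_add_intCast hs0.ne', Real.rpow_neg hs0.le]
        have := (Real.rpow_pos_of_pos hs0 α).ne'
        field_simp
        ring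
    rw [← intervalIntegral.integral_add_adjacent_intervals
      (hi.mono_set (uIcc_subset_uIcc_left hmem)) (hi.mono_set (uIcc_subset_uIcc_right hmem)),
      hzero τ le_rfl hετ, hint, max_eq_right (by rw [sub_nonneg, div_le_one ht0]; exact h.le)]
    have e1 : 1 - τ / t = (t - τ) / t := by field_simp
    have hp : 0 ≤ t - τ := by linarith
    have e2 : t ^ (-α) * t = t ^ (1 - α) := by
      rw [sub_eq_neg_add 1 α, Real.rpow_add ht0, Real.rpow_one]
    have e3 : τ ^ (α - 1) = (τ ^ (1 - α))⁻¹ := by rw [← Real.rpow_neg hτ.le, neg_sub]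
    rw [sub_self, zero_div, Real.zero_rpow (by linarith), e1, Real.div_rpow hp hτ.le,
      Real.div_rpow hp ht0.le, e3, ← e2]
    have := (Real.rpow_pos_of_pos ht0 (-α)).ne'
    have := (Real.rpow_pos_of_pos hτ (1 - α)).ne'
    field_simp
    ring

/-- Bernoulli's inequality (1-s)^β ≤ 1 - βs for s ≤ 1; for s ≥ 1 the bracket in ρ equals 1. -/
theorem rho_ge {s : ℝ} (hα0 : 0 < α) (hα1 : α < 1) (hs : 0 < s) :
    s ^ (-(1 - α)) * min ((1 - α) * s) 1 ≤ rho α s := by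
  refine mul_le_mul_of_nonneg_left ?_ (Real.rpow_nonneg hs.le _)
  rcases le_total s 1 with h | h
  · rw [max_eq_right (by linarith)]
    have := _root_.rpow_one_add_le_one_add_mul_self (s := -s) (by linarith) (p := 1 - α)
      (by linarith) (by linarith)
    rw [← sub_eq_add_neg] at this
    linarith [min_le_left ((1 - α) * s) 1]
  · rw [max_eq_left (by linarith), Real.zero_rpow (by linarith), sub_zero]
    exact min_le_right _ _

theorem rho_pos {s : ℝ} (hα0 : 0 < α) (hα1 : α < 1) (hs : 0 < s) : 0 < rho α s :=
  (mul_pos (Real.rpow_pos_of_pos hs _) (lt_min (mul_pos (by linarith) hs) one_pos)).trans_le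
    (rho_ge hα0 hα1 hs)

theorem E1_pos (hτ : 0 < τ) (s : ℝ) : 0 < E1 α τ s :=
  Real.rpow_pos_of_pos (hτ.trans_le (le_max_left τ s)) _

theorem R1_pos {lam : ℝ} (hα0 : 0 < α) (hα1 : α < 1) (hlam : 0 ≤ lam) (hτ : 0 < τ) (ht : 0 < t) :
    0 < R1 α lam τ t := by
  have h1 : 0 < Real.Gamma (1 - α) := Real.Gamma_pos_of_pos (by linarith)
  have h2 := rho_pos hα0 hα1 (div_pos hτ ht)
  have h3 := E1_pos (α := α) hτ t
  unfold R1
  positivity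

end Barrier

/-! ### The comparison principle -/

section Comparison

variable {H : Type*} [NormedAddCommGroup H] [InnerProductSpace ℝ H] [CompleteSpace H]
  {α τ : ℝ} {e p : ℝ → H}

/-- If the norm of `e` touches the barrier `c + K E1 τ + η s^{α-1}` from below at time `t`, then the
fractional derivative of `e` at `t` in the direction `e t` is at least that of
`c + K E1 τ`. -/
theorem inner_ge_of_touches {t c K η : ℝ} {y : H} (hα0 : 0 < α) (hα1 : α < 1) (hτ : 0 < τ)
    (ht : 0 < t) (hη : 0 ≤ η) (he : ∀ ε ∈ Ioo 0 t, HasBddDeriv ε t e p)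
    (hy : Tendsto (kernelTrunc α t e p) (𝓝[>] 0) (𝓝 y))
    (hle : ∀ s ∈ Ioc 0 t, ‖e s‖ ≤ c + K * E1 α τ s + η * s ^ (α - 1))
    (heq : ‖e t‖ = c + K * E1 α τ t + η * t ^ (α - 1)) :
    ‖e t‖ * (t ^ (-α) * c + K * (t⁻¹ * rho α (τ / t))) ≤ inner ℝ (e t) y := by
  have hlim : Tendsto (fun ε => (inner ℝ (e t) (kernelTrunc α t e p ε) : ℝ)) (𝓝[>] 0)
      (𝓝 (inner ℝ (e t) y)) := tendsto_const_nhds.inner hy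
  refine ge_of_tendsto hlim ?_
  filter_upwards [Ioo_mem_nhdsGT (lt_min ht hτ)] with ε hε
  have hεt : ε < t := hε.2.trans_le (min_le_left _ _)
  have hετ : ε ≤ τ := hε.2.le.trans (min_le_right _ _)
  have hE := hasBddDeriv_E1 (α := α) hα1 hτ ε t
  -- On [ε,t] the function s^{α-1} is `E1` with parameter ε, so the same formula gives its
  -- truncation at ε as t⁻¹ρ(ε/t) > 0, and this contribution can be dropped.
  have hψ := hasBddDeriv_E1 (α := α) hα1 hε.1 ε t
  have hΦ1 := (hasBddDeriv_const ε t c).add (hE.const_smul K)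
  have hΦ := hΦ1.add (hψ.const_smul η)
  have heε := he ε ⟨hε.1, hεt⟩
  have hΦ' := hΦ.const_smul ‖e t‖
  have hψe : ∀ s ∈ Icc ε t, E1 α ε s = s ^ (α - 1) := fun s hs => by rw [E1, max_eq_right hs.1]
  have hnn := ((heε.inner_left (e t)).sub hΦ').kernelTrunc_nonneg hα0 hα1 hε.1.le hεt
    (fun s hs => by
      have h1 := real_inner_le_norm (e t) (e s)
      have h2 := mul_le_mul_of_nonneg_left (hle s ⟨hε.1.trans_le hs.1, hs.2⟩) (norm_nonneg (e t))
      simp only [smul_eq_mul, hψe s hs]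
      linarith)
    (by simp only [smul_eq_mul, hψe t ⟨hεt.le, le_rfl⟩, ← heq, real_inner_self_eq_norm_mul_norm,
          sub_self])
  rw [kernelTrunc_sub hα1 hεt.le (heε.inner_left _) hΦ', kernelTrunc_inner hα1 hεt.le heε,
    kernelTrunc_smul, kernelTrunc_add hα1 hεt.le hΦ1 (hψ.const_smul η),
    kernelTrunc_add hα1 hεt.le (hasBddDeriv_const ε t c) (hE.const_smul K), kernelTrunc_const,
    kernelTrunc_smul, kernelTrunc_smul, kernelTrunc_E1 hα1 hε.1 hετ hεt,
    kernelTrunc_E1 hα1 hε.1 le_rfl hεt] at hnn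
  simp only [smul_eq_mul] at hnn
  have hρ := (rho_pos hα0 hα1 (div_pos hε.1 ht)).le
  have hx : 0 ≤ ‖e t‖ * (η * (t⁻¹ * rho α (ε / t))) := by positivity
  linarith

/-- The comparison principle with the barrier `K E1 τ`. -/
theorem norm_le_of_residual_le {D : ℝ → H} {r : ℝ → ℝ} {T M K lam : ℝ} (hα0 : 0 < α) (hα1 : α < 1)
    (hτ : 0 < τ) (hT : 0 < T) (hlam : 0 ≤ lam) (hK : 0 ≤ K)
    (he : ∀ ε ∈ Ioo 0 T, HasBddDeriv ε T e p) (hM : ∀ s ∈ Ioc 0 T, ‖e s‖ ≤ M)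
    (hD : ∀ t ∈ Ioc 0 T,
      Tendsto (kernelTrunc α t e p) (𝓝[>] 0) (𝓝 (Real.Gamma (1 - α) • D t)))
    (hineq : ∀ t ∈ Ioc 0 T, inner ℝ (e t) (D t) + lam * ‖e t‖ ^ 2 ≤ r t * ‖e t‖)
    (hr : ∀ t ∈ Ioc 0 T, r t ≤ K * R1 α lam τ t) :
    ‖e T‖ ≤ K * E1 α τ T := by
  by_contra! hcon
  obtain ⟨η, hη, hηT⟩ : ∃ η > 0, η * T ^ (α - 1) < ‖e T‖ - K * E1 α τ T := by
    have hp := Real.rpow_pos_of_pos hT (α - 1)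
    refine ⟨(‖e T‖ - K * E1 α τ T) / 2 / T ^ (α - 1), by
      have := sub_pos.2 hcon
      positivity, ?_⟩
    rw [div_mul_cancel₀ _ hp.ne']
    linarith
  set z : ℝ → ℝ := fun s => ‖e s‖ - K * E1 α τ s - η * s ^ (α - 1) with hz
  have hzT : 0 < z T := by simp only [hz]; linarith
  -- The singular term exceeds the bound M of ‖e‖ near 0, so a positive maximum of z can be sought
  -- on a compact interval away from 0.
  obtain ⟨δ, hδ, hzδ⟩ : ∃ δ ∈ Ioo 0 T, ∀ s ∈ Ioc 0 δ, z s ≤ 0 := by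
    have h1 : Tendsto (fun s : ℝ => η * s ^ (α - 1)) (𝓝[>] 0) atTop :=
      (tendsto_rpow_neg_nhdsGT_zero (by linarith)).const_mul_atTop hη
    have h2 := (h1.eventually_ge_atTop M).and (Ioc_mem_nhdsGT hT)
    obtain ⟨u, hu, hsub⟩ := mem_nhdsGT_iff_exists_Ioc_subset.1 h2
    refine ⟨min u (T / 2), ⟨lt_min hu (by linarith), (min_le_right _ _).trans_lt (by linarith)⟩,
      fun s hs => ?_⟩
    have h3 := hsub ⟨hs.1, hs.2.trans (min_le_left _ _)⟩
    have h4 := hM s h3.2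
    have h5 := mul_nonneg hK (E1_pos (α := α) hτ s).le
    have h6 := h3.1
    simp only [hz]
    linarith
  have hzc : ContinuousOn z (Icc δ T) := by
    refine ((he δ hδ).continuousOn.norm.sub
      ((continuous_E1 hτ).continuousOn.const_smul K)).sub (continuousOn_const.mul ?_)
    exact continuousOn_id.rpow_const fun s hs => Or.inl (hδ.1.trans_le hs.1).ne'
  obtain ⟨t, htm, htmax⟩ := isCompact_Icc.exists_isMaxOn ⟨T, hδ.2.le, le_rfl⟩ hzc
  have hzt : 0 < z t := hzT.trans_le (htmax ⟨hδ.2.le, le_rfl⟩)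
  have ht0 : 0 < t := hδ.1.trans_le htm.1
  have htT : t ∈ Ioc 0 T := ⟨ht0, htm.2⟩
  have hle : ∀ s ∈ Ioc 0 t, z s ≤ z t := fun s hs => by
    rcases le_total s δ with h | h
    · exact (hzδ s ⟨hs.1, h⟩).trans hzt.le
    · exact htmax ⟨h, hs.2.trans htm.2⟩
  have key := inner_ge_of_touches (c := z t) (K := K) (η := η) hα0 hα1 hτ ht0 hη.le
    (fun ε hε => (he ε ⟨hε.1, hε.2.trans_le htm.2⟩).mono le_rfl htm.2) (hD t htT)
    (fun s hs => by have := hle s hs; simp only [hz] at this ⊢; linarith)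
    (by simp only [hz]; ring)
  have hG : 0 < Real.Gamma (1 - α) := Real.Gamma_pos_of_pos (by linarith)
  have hEt := E1_pos (α := α) hτ t
  have hψ : 0 < t ^ (α - 1) := Real.rpow_pos_of_pos ht0 _
  have hk : 0 < t ^ (-α) := Real.rpow_pos_of_pos ht0 _
  have hnorm : K * E1 α τ t < ‖e t‖ := by
    have : 0 < η * t ^ (α - 1) := by positivity
    simp only [hz] at hzt
    linarith
  have hpos : 0 < ‖e t‖ := (mul_nonneg hK hEt.le).trans_lt hnorm
  rw [real_inner_smul_right] at key
  have h1 := mul_le_mul_of_nonneg_left (hineq t htT) hG.le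
  have h2 := mul_le_mul_of_nonneg_left (hr t htT) (mul_pos hG hpos).le
  have h3 : Real.Gamma (1 - α) * R1 α lam τ t
      = t⁻¹ * rho α (τ / t) + Real.Gamma (1 - α) * lam * E1 α τ t := by
    unfold R1
    field_simp
  -- After division by ‖e t‖ the ρ-terms cancel, and ‖e t‖ > K `E1` absorbs the λ-terms. Only t^{-α}
  -- z(t) ≤ 0 is left, which is false.
  have h4 : ‖e t‖ * (t ^ (-α) * z t + K * (t⁻¹ * rho α (τ / t)) + Real.Gamma (1 - α) * lam * ‖e t‖)
      ≤ ‖e t‖ * (K * (t⁻¹ * rho α (τ / t) + Real.Gamma (1 - α) * lam * E1 α τ t)) := by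
    rw [← h3]
    linarith
  have h5 := le_of_mul_le_mul_left h4 hpos
  have h6 : Real.Gamma (1 - α) * lam * (K * E1 α τ t) ≤ Real.Gamma (1 - α) * lam * ‖e t‖ :=
    mul_le_mul_of_nonneg_left hnorm.le (by positivity)
  have h7 := mul_pos hk hzt
  linarith

end Comparison

/-! ### From time regularity to the hypotheses of the comparison principle -/

section Regularity

variable {H : Type*} [NormedAddCommGroup H]

theorem HasBddDeriv.sub_const [NormedSpace ℝ H] {a b : ℝ} {v q : ℝ → H} (h : HasBddDeriv a b v q)
    (c : H) : HasBddDeriv a b (fun s => v s - c) q where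
  memLp := h.memLp
  integral_eq s hs r hr := by rw [← h.integral_eq s hs r hr]; abel

theorem TimeRegular.hasBddDeriv [NormedSpace ℝ H] {T ε : ℝ} {v : ℝ → H} (h : TimeRegular T v)
    (hε : ε ∈ Ioo 0 T) : HasBddDeriv ε T v (deriv v) :=
  ⟨(h ε T hε.1 hε.2 le_rfl).2.2.1, (h ε T hε.1 hε.2 le_rfl).2.2.2⟩

/-- An essentially bounded continuous function is bounded. -/
theorem norm_le_of_ae_of_continuousOn {a b M : ℝ} {v : ℝ → H}
    (hae : ∀ᵐ s ∂volume.restrict (Ioo a b), ‖v s‖ ≤ M) (hc : ContinuousOn v (Ioc a b)) :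
    ∀ s ∈ Ioc a b, ‖v s‖ ≤ M := by
  intro s hs
  by_contra! hcon
  have hcs : ContinuousWithinAt v (Ioo a s) s :=
    (hc s hs).mono fun x hx => ⟨hx.1, hx.2.le.trans hs.2⟩
  -- A left neighbourhood is used because s may be the endpoint b.
  have hev : ∀ᶠ x in 𝓝[<] s, M < ‖v x‖ := by
    rw [← nhdsWithin_Ioo_eq_nhdsLT hs.1]
    exact hcs.norm.eventually (lt_mem_nhds hcon)
  obtain ⟨l, hl, hsub⟩ := (mem_nhdsLT_iff_exists_mem_Ico_Ioo_subset hs.1).1 hev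
  rw [ae_restrict_iff' measurableSet_Ioo] at hae
  have hzero : volume (Ioo l s) = 0 := by
    refine measure_mono_null (fun x hx => ?_) hae
    exact fun hx' => absurd (hx' ⟨hl.1.trans_lt hx.1, hx.2.trans_le hs.2⟩) (not_le.2 (hsub hx))
  rw [Real.volume_Ioo, ENNReal.ofReal_eq_zero] at hzero
  linarith [hl.2]

theorem TimeRegular.exists_bound [NormedSpace ℝ H] {T : ℝ} {v : ℝ → H} (h : TimeRegular T v)
    (hT : 0 < T) : ∃ M, ∀ s ∈ Ioc 0 T, ‖v s‖ ≤ M := by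
  have hm := (h (T / 2) T (by linarith) (by linarith) le_rfl).1
  refine ⟨(eLpNorm v ∞ (volume.restrict (Ioo 0 T))).toReal,
    norm_le_of_ae_of_continuousOn ?_ fun s hs => ?_⟩
  · have h2 := hm.2
    rw [eLpNorm_exponent_top] at *
    filter_upwards [ae_le_eLpNormEssSup (f := v) (μ := volume.restrict (Ioo 0 T))] with x hx
    simpa using ENNReal.toReal_mono h2.ne hx
  · have hc := (h.hasBddDeriv (ε := s / 2)
      ⟨by linarith [hs.1], by linarith [hs.1, hs.2]⟩).continuousOn
    refine ((hc s ⟨by linarith [hs.1], hs.2⟩).mono_of_mem_nhdsWithin ?_)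
    exact mem_of_superset (inter_mem_nhdsWithin _ (Ioi_mem_nhds (half_lt_self hs.1)))
      fun x hx => ⟨le_of_lt hx.2, hx.1.2⟩

variable [InnerProductSpace ℝ H] [CompleteSpace H]

/-- For time-regular functions the Caputo derivative is a genuine limit. -/
theorem TimeRegular.tendsto_kernelTrunc {α T t : ℝ} {v : ℝ → H} (h : TimeRegular T v)
    (hα0 : 0 < α) (hα1 : α < 1) (ht : t ∈ Ioc 0 T) :
    Tendsto (kernelTrunc α t (fun s => v s - v 0) (deriv v)) (𝓝[>] 0)
      (𝓝 (Real.Gamma (1 - α) • caputoDeriv α v t)) := by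
  obtain ⟨M, hM⟩ := h.exists_bound (ht.1.trans_le ht.2)
  have hG : 0 < Real.Gamma (1 - α) := Real.Gamma_pos_of_pos (by linarith)
  obtain ⟨y, hy⟩ := exists_tendsto_kernelTrunc (M := M + ‖v 0‖) hα0 hα1 ht.1
    (v := fun s => v s - v 0) (q := deriv v)
    (fun ε hε => ((h.hasBddDeriv ⟨hε.1, hε.2.trans_le ht.2⟩).mono le_rfl ht.2).sub_const (v 0))
    (fun s hs => (norm_sub_le _ _).trans
      (add_le_add_left (hM s ⟨hs.1, hs.2.trans ht.2⟩) _))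
  have hlim : caputoDeriv α v t = (Real.Gamma (1 - α))⁻¹ • y :=
    (hy.const_smul (Real.Gamma (1 - α))⁻¹).limUnder_eq
  rwa [hlim, smul_inv_smul₀ hG.ne']

end Regularity

/-- The error at time `t` is bounded by the barrier `K E1 τ` if the residual is bounded by
`K R1` up to time `t`. -/
theorem norm_sub_le_of_residual {H : Type*} [NormedAddCommGroup H] [InnerProductSpace ℝ H]
    [CompleteSpace H] {α τ T lam t K : ℝ} {u uh : ℝ → H} {r : ℝ → ℝ} (hα0 : 0 < α) (hα1 : α < 1)
    (hτ : 0 < τ) (hlam : 0 ≤ lam) (hK : 0 ≤ K) (hu : TimeRegular T u) (huh : TimeRegular T uh)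
    (h0 : uh 0 = u 0) (ht : t ∈ Ioc 0 T)
    (hineq : ∀ s ∈ Ioc 0 T, inner ℝ (uh s - u s) (caputoDeriv α uh s - caputoDeriv α u s)
      + lam * ‖uh s - u s‖ ^ 2 ≤ r s * ‖uh s - u s‖)
    (hr : ∀ s ∈ Ioc 0 t, r s ≤ K * R1 α lam τ s) :
    ‖uh t - u t‖ ≤ K * E1 α τ t := by
  obtain ⟨M, hM⟩ := hu.exists_bound (ht.1.trans_le ht.2)
  obtain ⟨N, hN⟩ := huh.exists_bound (ht.1.trans_le ht.2)
  refine norm_le_of_residual_le (e := fun s => uh s - u s) (p := fun s => deriv uh s - deriv u s)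
    (D := fun s => caputoDeriv α uh s - caputoDeriv α u s) (r := r) (M := N + M)
    hα0 hα1 hτ ht.1 hlam hK (fun ε hε => ?_) (fun s hs => ?_) (fun s hs => ?_)
    (fun s hs => hineq s ⟨hs.1, hs.2.trans ht.2⟩) hr
  · have hε' : ε ∈ Ioo 0 T := ⟨hε.1, hε.2.trans_le ht.2⟩
    exact ((huh.hasBddDeriv hε').sub (hu.hasBddDeriv hε')).mono le_rfl ht.2
  · have hs' : s ∈ Ioc 0 T := ⟨hs.1, hs.2.trans ht.2⟩
    exact (norm_sub_le _ _).trans (add_le_add (hN s hs') (hM s hs'))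
  · have hs' : s ∈ Ioc 0 T := ⟨hs.1, hs.2.trans ht.2⟩
    have hlim := (huh.tendsto_kernelTrunc hα0 hα1 hs').sub (hu.tendsto_kernelTrunc hα0 hα1 hs')
    rw [← smul_sub] at hlim
    refine hlim.congr' ?_
    filter_upwards [Ioo_mem_nhdsGT hs.1] with ε hε
    have hε' : ε ∈ Ioo 0 T := ⟨hε.1, hε.2.trans_le hs'.2⟩
    rw [← kernelTrunc_sub hα1 hε.2.le
      (((huh.hasBddDeriv hε').mono le_rfl hs'.2).sub_const (uh 0))
      (((hu.hasBddDeriv hε').mono le_rfl hs'.2).sub_const (u 0))]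
    -- The common initial value cancels, so the truncations of e need no correction at time 0.
    simp only [h0, sub_sub_sub_cancel_right]

/-- For t ≤ τ the argument of ρ is at least 1, where ρ is the pure power s^{-β}, and `E1` is
constant. -/
theorem R1_eq_of_le {α lam τ t : ℝ} (hα1 : α < 1) (ht : 0 < t) (h : t ≤ τ) :
    R1 α lam τ t = τ ^ (α - 1) * R0 α lam t := by
  have hτ : 0 < τ := ht.trans_le h
  have hrho := inv_mul_div_rpow (α := α) hτ ht
  rw [R1, R0, E1, max_eq_left h, rho,
    max_eq_left (by rw [sub_nonpos, le_div_iff₀ ht]; linarith), Real.zero_rpow (by linarith)]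
  linear_combination (Real.Gamma (1 - α))⁻¹ * hrho

end FracParabolic

/-! ### The parabolic problem -/

/-- Here `L v w = ⟨𝓛 v, w⟩` and `f t w = ⟨f(·,t), w⟩` for `v, w ∈ H¹₀(Ω)` (the values of `𝓛` and `f`
are functionals on `H¹₀(Ω)`; elements of `H⁻¹(Ω)` and of `L₂(Ω)` are such). The fractional parabolic
equation and the definition of the residual are identities of functionals on `H¹₀(Ω)`, at each
`0 < t ≤ T`. The suprema are taken in `[0, ∞]`. -/
theorem corollary2 {d : ℕ} {Ω : Set (EuclideanSpace ℝ (Fin d))} (hΩ : IsOpen Ω)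
    {α T lam : ℝ} (hα0 : 0 < α) (hα1 : α < 1) (hT : 0 < T) (hlam : 0 ≤ lam)
    (L : FracParabolic.H10 Ω →ₗ[ℝ] Module.Dual ℝ (FracParabolic.H10 Ω))
    (hL : ∀ v : FracParabolic.H10 Ω, lam * ‖(v : FracParabolic.L2 Ω)‖ ^ 2 ≤ L v v)
    (f : ℝ → Module.Dual ℝ (FracParabolic.H10 Ω))
    (u₀ : FracParabolic.L2 Ω) (u uh Rh : ℝ → FracParabolic.L2 Ω)
    (hu : FracParabolic.TimeRegular T u) (huh : FracParabolic.TimeRegular T uh)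
    (huV : ∀ t ∈ Ioc 0 T, u t ∈ FracParabolic.H10 Ω)
    (huhV : ∀ t ∈ Ioc 0 T, uh t ∈ FracParabolic.H10 Ω)
    (hu0 : u 0 = u₀) (huh0 : uh 0 = u₀)
    (hsol : ∀ (t : ℝ) (ht : t ∈ Ioc 0 T) (w : FracParabolic.H10 Ω),
      inner ℝ (FracParabolic.caputoDeriv α u t) (w : FracParabolic.L2 Ω)
        + L ⟨u t, huV t ht⟩ w = f t w)
    (hRh : ∀ (t : ℝ) (ht : t ∈ Ioc 0 T) (w : FracParabolic.H10 Ω),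
      inner ℝ (Rh t) (w : FracParabolic.L2 Ω) =
        inner ℝ (FracParabolic.caputoDeriv α uh t) (w : FracParabolic.L2 Ω)
          + L ⟨uh t, huhV t ht⟩ w - f t w) :
    (∀ t ∈ Ioc 0 T,
      ENNReal.ofReal ‖uh t - u t‖ ≤
        ⨆ s ∈ Ioc 0 t, ENNReal.ofReal (‖Rh s‖ / FracParabolic.R0 α lam s)) ∧
    (∀ τ : ℝ, 0 < τ → ∀ t ∈ Ioc 0 T,
      ENNReal.ofReal ‖uh t - u t‖ ≤
        ENNReal.ofReal (t ^ (α - 1)) *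
          ⨆ s ∈ Ioc 0 t, ENNReal.ofReal (‖Rh s‖ / FracParabolic.R1 α lam τ s)) ∧
    (∀ τ : ℝ, 0 < τ → ∀ t ∈ Ioc 0 T,
      ENNReal.ofReal ‖uh t - u t‖ ≤
        ENNReal.ofReal (FracParabolic.E1 α τ t) *
          ⨆ s ∈ Ioc 0 t, ENNReal.ofReal (‖Rh s‖ / FracParabolic.R1 α lam τ s)) ∧
    (∀ s : ℝ, 0 < s →
      s ^ (-(1 - α)) * min ((1 - α) * s) 1 ≤ FracParabolic.rho α s) := by
  have e0 : uh 0 = u 0 := huh0.trans hu0.symm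
  have hineq : ∀ s ∈ Ioc 0 T,
      inner ℝ (uh s - u s) (FracParabolic.caputoDeriv α uh s - FracParabolic.caputoDeriv α u s)
        + lam * ‖uh s - u s‖ ^ 2 ≤ ‖Rh s‖ * ‖uh s - u s‖ := by
    intro s hs
    let w : FracParabolic.H10 Ω := ⟨uh s, huhV s hs⟩ - ⟨u s, huV s hs⟩
    have hw : (w : FracParabolic.L2 Ω) = uh s - u s := rfl
    have h1 := hsol s hs w
    have h2 := hRh s hs w
    have h3 := hL w
    have h4 : L w w = L ⟨uh s, huhV s hs⟩ w - L ⟨u s, huV s hs⟩ w := by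
      rw [show L w = L ⟨uh s, huhV s hs⟩ - L ⟨u s, huV s hs⟩ from map_sub _ _ _,
        LinearMap.sub_apply]
    have h5 := real_inner_le_norm (Rh s) (w : FracParabolic.L2 Ω)
    rw [hw] at h1 h2 h3 h5
    rw [real_inner_comm, inner_sub_left]
    linarith
  have main : ∀ τ : ℝ, 0 < τ → ∀ t ∈ Ioc 0 T,
      ENNReal.ofReal ‖uh t - u t‖ ≤
        ENNReal.ofReal (FracParabolic.E1 α τ t) *
          ⨆ s ∈ Ioc 0 t, ENNReal.ofReal (‖Rh s‖ / FracParabolic.R1 α lam τ s) := by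
    intro τ hτ t ht
    have hE := FracParabolic.E1_pos (α := α) hτ t
    set S := ⨆ s ∈ Ioc 0 t, ENNReal.ofReal (‖Rh s‖ / FracParabolic.R1 α lam τ s) with hS
    -- If S is infinite, so is the right-hand side because `E1` > 0; otherwise K = `S.toReal` is
    -- admissible.
    rcases eq_or_ne S ∞ with hinf | hfin
    · rw [hinf, ENNReal.mul_top (ENNReal.ofReal_pos.2 hE).ne']
      exact le_top
    · rw [← ENNReal.ofReal_toReal hfin, ← ENNReal.ofReal_mul hE.le, mul_comm]
      refine ENNReal.ofReal_le_ofReal (FracParabolic.norm_sub_le_of_residual (r := fun s => ‖Rh s‖)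
        hα0 hα1 hτ hlam ENNReal.toReal_nonneg hu huh e0 ht hineq fun s hs => ?_)
      have hR := FracParabolic.R1_pos hα0 hα1 hlam hτ hs.1
      rw [← div_le_iff₀ hR, ← ENNReal.ofReal_le_iff_le_toReal hfin, hS]
      exact le_iSup₂ (f := fun s (_ : s ∈ Ioc 0 t) =>
        ENNReal.ofReal (‖Rh s‖ / FracParabolic.R1 α lam τ s)) s hs
  refine ⟨fun t ht => ?_, fun τ hτ t ht => (main τ hτ t ht).trans ?_, main,
    fun s hs => FracParabolic.rho_ge hα0 hα1 hs⟩
  -- With τ = T, the factor T^{α-1} of `E1` cancels the one in `R1` = T^{α-1} `R0`.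
  · have hTp : 0 < T ^ (α - 1) := Real.rpow_pos_of_pos hT _
    refine (main T hT t ht).trans ?_
    rw [FracParabolic.E1, max_eq_left ht.2, ENNReal.mul_iSup]
    refine iSup_mono fun s => ?_
    rw [ENNReal.mul_iSup]
    refine iSup_mono fun hs => ?_
    rw [← ENNReal.ofReal_mul hTp.le, FracParabolic.R1_eq_of_le hα1 hs.1 (hs.2.trans ht.2),
      ← mul_div_assoc, mul_div_mul_left _ _ hTp.ne']
  · refine mul_le_mul_left (ENNReal.ofReal_le_ofReal ?_) _
    exact Real.rpow_le_rpow_of_nonpos ht.1 (le_max_right _ _) (by linarith)
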